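/- Let $F$ be a field, let $n\ge 1$ be an integer, and let $\mathcal M$ be an $(n+1)\times(2n+1)$ matrix over $F$. For $c_1,\dots,c_{n+1}\in\{1,\dots,2n+1\}$ let $p_{c_1,\dots,c_{n+1}}$ be the determinant of the matrix formed by the columns $c_1,\dots,c_{n+1}$ of $\mathcal M$, in this order (Plücker coordinates). Assume that $p_{c_1,\dots,c_{n+1}}\neq 0$ whenever $c_1<\dots<c_{n+1}$ (so $\mathcal M$ has full rank and defines a point of $\mathrm{Gr}(n+1,2n+1)$). For $q\in\{1,\dots,2n+1\}$ write $\{1,\dots,2n+1\}\setminus\{q\}=\{a_1<a_2<\dots<a_{2n}\}$ and define $n\times n$ matrices $A^{(q)}$, $B^{(q)}$, with row index $i$ and column index $j$, by $$(A^{(q)})_i^j=(-1)^i\,\frac{p_{a_{2j},\,a_1,a_3,\dots,\hat a_{2i-1},\dots,a_{2n-1},\,q}}{p_{a_1,a_3,\dots,a_{2n-1},\,q}},\qquad (B^{(q)})_i^j=(-1)^i\,\frac{p_{a_{2j-1},\,a_2,a_4,\dots,\hat a_{2i},\dots,a_{2n},\,q}}{p_{a_2,a_4,\dots,a_{2n},\,q}},$$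 where a hat means omission. Consider the two sequences of pairs of length $n(n+1)/2$: the initial sequence of all pairs $(2k-1,2l)$ and the final sequence of all pairs $(2k,2l+1)$, $1\le k\le l\le n$, each in lexicographic order. Let $\mathcal B_q\subset\{1,\dots,n(n+1)/2\}$ be the set of positions at which $q$ belongs to the pair of at least one of the two sequences; it has exactly $n$ elements $b_{q,1}<\dots<b_{q,n}$. For an $n\times n$ matrix $X$ let $X_{\mathcal B_q}$ be the square matrix of size $n(n+1)/2$ that has $X$ in rows and columns $b_{q,1},\dots,b_{q,n}$ and acts as the identity in the remaining positions. Then the direct-sum $(2n+1)$-gon equation $$A^{(1)}_{\mathcal B_1}A^{(3)}_{\mathcal B_3}\cdots A^{(2n+1)}_{\mathcal B_{2n+1}}=A^{(2n)}_{\mathcal B_{2n}}A^{(2n-2)}_{\mathcal B_{2n-2}}\cdots A^{(2)}_{\mathcal B_2}$$ holds. Moreover, $B^{(q)}=(A^{(q)})^{-1}$ for every $q$, and the inverse $(2n+1)$-gon equation $$B^{(2)}_{\mathcal B_2}B^{(4)}_{\mathcal B_4}\cdots B^{(2n)}_{\mathcal B_{2n}}=B^{(2n+1)}_{\mathcal B_{2n+1}}B^{(2n-1)}_{\mathcal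 B_{2n-1}}\cdots B^{(1)}_{\mathcal B_1}$$ holds. -/

import Mathlib

/- All numbering is shifted to start at `0`: the vertex `q ∈ {1, …, 2n+1}` of the polygon (equivalently, the
`q`-th column of the matrix) is the element `q - 1` of `Fin (2 * n + 1)`.  So odd vertices `1, 3, …, 2n+1`
are the elements `0, 2, …, 2n`, and even vertices `2, 4, …, 2n` are `1, 3, …, 2n-1`. -/

namespace Polygon

/-- The `k`-th odd vertex `2k + 1` (counting `k` from `0`), `k = 0, …, n`. -/
def oddVertex {n : ℕ} (k : Fin (n + 1)) : Fin (2 * n + 1) := ⟨2 * k, by omega⟩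

/-- The `k`-th even vertex `2k + 2` (counting `k` from `0`), `k = 0, …, n - 1`. -/
def evenVertex {n : ℕ} (k : Fin n) : Fin (2 * n + 1) := ⟨2 * k + 1, by omega⟩

/-! ### Positions in the row of length `n(n+1)/2` -/

/-- The positions `1, …, n(n+1)/2` of the row, indexed by the pairs `(k, l)` with `k ≤ l` in the
lexicographic order. -/
abbrev Position (n : ℕ) : Type := {x : Fin n ×ₗ Fin n // (ofLex x).1 ≤ (ofLex x).2}

/-- The entry of the initial sequence `(1,2), (1,4), …, (1,2n), (3,4), …, (2n-1,2n)` at a position: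
the pair (`k`-th odd vertex, `l`-th even vertex), `k ≤ l`, in lexicographic order. -/
def initialPair {n : ℕ} (x : Position n) : Fin (2 * n + 1) × Fin (2 * n + 1) :=
  (oddVertex (ofLex x.1).1.castSucc, evenVertex (ofLex x.1).2)

/-- The entry of the final sequence `(2,3), (2,5), …, (2,2n+1), (4,5), …, (2n,2n+1)` at a position:
the pair (`k`-th even vertex, `(l+1)`-st odd vertex), `k ≤ l`, in lexicographic order. -/
def finalPair {n : ℕ} (x : Position n) : Fin (2 * n + 1) × Fin (2 * n + 1) :=
  (evenVertex (ofLex x.1).1, oddVertex (ofLex x.1).2.succ)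

/-- The set `𝓑_q` of positions for which `q` is present in the pair at this position in at least one of
the initial and the final sequence. -/
def positions {n : ℕ} (q : Fin (2 * n + 1)) : Finset (Position n) :=
  Finset.univ.filter fun x =>
    (q = (initialPair x).1 ∨ q = (initialPair x).2) ∨ (q = (finalPair x).1 ∨ q = (finalPair x).2)

theorem mem_positions {n : ℕ} (q : Fin (2 * n + 1)) (x : Position n) :
    x ∈ positions q ↔
      ((q : ℕ) = 2 * (ofLex x.1).1 ∨ (q : ℕ) = 2 * (ofLex x.1).2 + 1) ∨
        ((q : ℕ) = 2 * (ofLex x.1).1 + 1 ∨ (q : ℕ) = 2 * (ofLex x.1).2 + 2) := by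
  simp [positions, initialPair, finalPair, oddVertex, evenVertex, Fin.ext_iff, mul_add]

/-- An explicit listing of `𝓑_q`, used to count its elements. -/
def listing {n : ℕ} (q : Fin (2 * n + 1)) (i : Fin n) : Position n :=
  if h : 2 * (i : ℕ) < q then
    ⟨toLex (i, ⟨((q : ℕ) - 1) / 2, by omega⟩), by
      simp only [ofLex_toLex, Fin.le_def]; omega⟩
  else
    ⟨toLex (⟨(q : ℕ) / 2, by omega⟩, i), by
      simp only [ofLex_toLex, Fin.le_def]; omega⟩

theorem positions_eq_image {n : ℕ} (q : Fin (2 * n + 1)) :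
    positions q = Finset.univ.image (listing q) := by
  ext ⟨x, hx⟩
  obtain ⟨k, l⟩ := x
  simp only [mem_positions, Finset.mem_image, Finset.mem_univ, true_and, listing]
  change ((k : Fin n) : ℕ) ≤ ((l : Fin n) : ℕ) at hx
  change ((q : ℕ) = 2 * (k : Fin n) ∨ (q : ℕ) = 2 * (l : Fin n) + 1) ∨
        ((q : ℕ) = 2 * (k : Fin n) + 1 ∨ (q : ℕ) = 2 * (l : Fin n) + 2) ↔ _
  constructor
  · intro h
    by_cases hl : (q : ℕ) = 2 * (l : Fin n) + 1 ∨ (q : ℕ) = 2 * (l : Fin n) + 2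
    · refine ⟨k, ?_⟩
      rw [dif_pos (by omega)]
      refine Subtype.ext (Prod.ext rfl (Fin.ext ?_))
      change ((q : ℕ) - 1) / 2 = ((l : Fin n) : ℕ)
      omega
    · refine ⟨l, ?_⟩
      rw [dif_neg (by omega)]
      refine Subtype.ext (Prod.ext (Fin.ext ?_) rfl)
      change (q : ℕ) / 2 = ((k : Fin n) : ℕ)
      omega
  · rintro ⟨i, hi⟩
    split_ifs at hi with h
    · have h1 : i = k := congrArg (fun z : Position n => (ofLex z.1).1) hi
      have h2 : ((q : ℕ) - 1) / 2 = (l : Fin n) :=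
        congrArg (fun z : Position n => ((ofLex z.1).2 : ℕ)) hi
      subst h1
      omega
    · have h1 : i = l := congrArg (fun z : Position n => (ofLex z.1).2) hi
      have h2 : (q : ℕ) / 2 = (k : Fin n) :=
        congrArg (fun z : Position n => ((ofLex z.1).1 : ℕ)) hi
      subst h1
      omega

theorem listing_injective {n : ℕ} (q : Fin (2 * n + 1)) : Function.Injective (listing q) := by
  intro i j h
  have h1 := congrArg (fun z : Position n => ((ofLex z.1).1 : ℕ)) h
  have h2 := congrArg (fun z : Position n => ((ofLex z.1).2 : ℕ)) h
  simp only [listing] at h1 h2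
  apply Fin.ext
  split_ifs at h1 h2 <;> simp only [ofLex_toLex] at h1 h2 <;> omega

/-- The set `𝓑_q` has exactly `n` elements. -/
theorem card_positions {n : ℕ} (q : Fin (2 * n + 1)) : (positions q).card = n := by
  rw [positions_eq_image, Finset.card_image_of_injective _ (listing_injective q), Finset.card_fin]

/-! ### The polygon equation -/

section Equation

variable {F : Type*} [Field F] {n : ℕ}

/-- The matrix `A_𝓑`, `𝓑 = 𝓑_q`: the matrix `A` placed in the rows and columns with numbers in
`𝓑_q = {b_{q,1} < … < b_{q,n}}`, and the identity matrix in the remaining positions. -/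
def place (q : Fin (2 * n + 1)) (A : Matrix (Fin n) (Fin n) F) :
    Matrix (Position n) (Position n) F :=
  Matrix.of fun x y =>
    if h : x ∈ positions q ∧ y ∈ positions q then
      A (((positions q).orderIsoOfFin (card_positions q)).symm ⟨x, h.1⟩)
        (((positions q).orderIsoOfFin (card_positions q)).symm ⟨y, h.2⟩)
    else if x = y then 1 else 0

/-- The direct-sum `(2n+1)`-gon equation
`A⁽¹⁾ A⁽³⁾ ⋯ A⁽²ⁿ⁺¹⁾ = A⁽²ⁿ⁾ A⁽²ⁿ⁻²⁾ ⋯ A⁽²⁾`, each `A⁽q⁾` being placed in the positions `𝓑_q`. -/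
def PolygonEquation (A : Fin (2 * n + 1) → Matrix (Fin n) (Fin n) F) : Prop :=
  (List.ofFn fun k : Fin (n + 1) => place (oddVertex k) (A (oddVertex k))).prod =
    (List.ofFn fun k : Fin n => place (evenVertex k.rev) (A (evenVertex k.rev))).prod

/-- The inverse `(2n+1)`-gon equation
`B⁽²⁾ B⁽⁴⁾ ⋯ B⁽²ⁿ⁾ = B⁽²ⁿ⁺¹⁾ B⁽²ⁿ⁻¹⁾ ⋯ B⁽¹⁾`, each `B⁽q⁾` being placed in the positions `𝓑_q`. -/
def InversePolygonEquation (B : Fin (2 * n + 1) → Matrix (Fin n) (Fin n) F) : Prop :=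
  (List.ofFn fun k : Fin n => place (evenVertex k) (B (evenVertex k))).prod =
    (List.ofFn fun k : Fin (n + 1) => place (oddVertex k.rev) (B (oddVertex k.rev))).prod

/-! ### The matrices built from Plücker coordinates -/

/-- The Plücker coordinate `p_{c_1, …, c_{n+1}}`: the determinant made of the columns
`c_1, …, c_{n+1}` of `M`, in this order. -/
def pluecker (M : Matrix (Fin (n + 1)) (Fin (2 * n + 1)) F) (c : Fin (n + 1) → Fin (2 * n + 1)) : F :=
  (M.submatrix id c).det

/-- For `{a_1 < … < a_{2n}}` the complement of `q`: the elements `a_1, a_3, …, a_{2n-1}`. -/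
def aOdd (q : Fin (2 * n + 1)) (i : Fin n) : Fin (2 * n + 1) :=
  q.succAbove ⟨2 * i, by omega⟩

/-- For `{a_1 < … < a_{2n}}` the complement of `q`: the elements `a_2, a_4, …, a_{2n}`. -/
def aEven (q : Fin (2 * n + 1)) (i : Fin n) : Fin (2 * n + 1) :=
  q.succAbove ⟨2 * i + 1, by omega⟩

/-- The ratio `(-1)^i p_{t, s_1, …, ŝ_i, …, s_n, q} / p_{s_1, …, s_n, q}`.
As `i : Fin n` counts from `0`, the exponent is `i + 1`. -/
def plueckerRatio (M : Matrix (Fin (n + 1)) (Fin (2 * n + 1)) F) (s : Fin n → Fin (2 * n + 1))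
    (q t : Fin (2 * n + 1)) (i : Fin n) : F :=
  (-1) ^ ((i : ℕ) + 1) *
    (pluecker M (Fin.cons t
        (i.castSucc.removeNth (Fin.snoc s q : Fin (n + 1) → Fin (2 * n + 1)))) /
      pluecker M (Fin.snoc s q))

/-- `(A⁽q⁾)_i^j = (-1)^i p_{a_{2j}, a_1, a_3, …, â_{2i-1}, …, a_{2n-1}, q} / p_{a_1, a_3, …, a_{2n-1}, q}`,
with row index `i` and column index `j`. -/
def matA (M : Matrix (Fin (n + 1)) (Fin (2 * n + 1)) F) (q : Fin (2 * n + 1)) :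
    Matrix (Fin n) (Fin n) F :=
  Matrix.of fun i j => plueckerRatio M (aOdd q) q (aEven q j) i

/-- `(B⁽q⁾)_i^j = (-1)^i p_{a_{2j-1}, a_2, a_4, …, â_{2i}, …, a_{2n}, q} / p_{a_2, a_4, …, a_{2n}, q}`,
with row index `i` and column index `j`. -/
def matB (M : Matrix (Fin (n + 1)) (Fin (2 * n + 1)) F) (q : Fin (2 * n + 1)) :
    Matrix (Fin n) (Fin n) F :=
  Matrix.of fun i j => plueckerRatio M (aEven q) q (aOdd q j) i

end Equation

end Polygon

/-!
Write `v_a` for the columns of `M`, vectors in `F^(n+1)`. By Cramer's rule, for every linear functional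
`φ` that vanishes on `v_q`, the row `(φ(v_{a_1}), φ(v_{a_3}), …)` multiplied by `A⁽q⁾` is
`-(φ(v_{a_2}), φ(v_{a_4}), …)`, and `B⁽q⁾` goes back (`sum_mul_plueckerRatio`). As the values of `φ` on
`a_1, a_3, …` are arbitrary, `A⁽q⁾` and `B⁽q⁾` are inverse to each other.

For the polygon equation, let `ω` be an alternating bilinear form on `F^(n+1)` and give the edge
`{a, b}`, `a < b`, of the polygon the number `(-1)^(a+b) ω(v_a, v_b)`. Taking `φ = ω(v_q, ·)`, one sees
that `A⁽q⁾` carries the numbers on the edges `{q, a_1}, {q, a_3}, …` to those on the edges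
`{q, a_2}, {q, a_4}, …` (`sum_edgeValue_mul_matA`). Hence both sides of the polygon equation carry
the row of numbers on the initial pairs to the row on the final pairs. It remains to see
that the rows on the initial pairs fill the whole space. Alternating forms have dimension
`n(n+1)/2`, so it is enough that a form `ω` with zero initial row vanishes (`form_eq_zero`). Going through
`q = 1, 3, …, 2n+1`, the functional `ω(v_q, ·)` vanishes on `v_q`, on `v_a` for odd `a < q` by the
previous steps, and on `v_a` for even `a > q` by assumption; these are `n + 1` independent columns, so it
is zero; and the odd columns span.

Inverting both sides of the polygon equation gives the inverse polygon equation.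
-/

namespace Polygon

open Matrix

/-! ### Vertices and positions -/

section Combinatorics

variable {n : ℕ}

theorem aOdd_val (q : Fin (2 * n + 1)) (i : Fin n) :
    (aOdd q i : ℕ) = if 2 * (i : ℕ) < q then 2 * (i : ℕ) else 2 * i + 1 := by
  unfold aOdd Fin.succAbove
  simp only [Fin.lt_def, Fin.val_castSucc]
  split_ifs <;> simp

theorem aEven_val (q : Fin (2 * n + 1)) (i : Fin n) :
    (aEven q i : ℕ) = if 2 * (i : ℕ) + 1 < q then 2 * (i : ℕ) + 1 else 2 * i + 2 := by
  unfold aEven Fin.succAbove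
  simp only [Fin.lt_def, Fin.val_castSucc]
  split_ifs <;> simp

theorem snoc_succAbove_injective (q : Fin (2 * n + 1)) {g : Fin n → Fin (2 * n)}
    (hg : Function.Injective g) :
    Function.Injective
      (Fin.snoc (fun i => q.succAbove (g i)) q : Fin (n + 1) → Fin (2 * n + 1)) := by
  rw [Fin.snoc_injective_iff]
  refine ⟨Fin.succAbove_right_injective.comp hg, ?_⟩
  rintro ⟨i, hi⟩
  exact Fin.succAbove_ne q _ hi

theorem snoc_aOdd_injective (q : Fin (2 * n + 1)) :
    Function.Injective (Fin.snoc (aOdd q) q : Fin (n + 1) → Fin (2 * n + 1)) :=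
  snoc_succAbove_injective q (g := fun i => ⟨2 * i, by omega⟩) fun i j h => by
    simp only [Fin.mk.injEq] at h
    omega

theorem snoc_aEven_injective (q : Fin (2 * n + 1)) :
    Function.Injective (Fin.snoc (aEven q) q : Fin (n + 1) → Fin (2 * n + 1)) :=
  snoc_succAbove_injective q (g := fun i => ⟨2 * i + 1, by omega⟩) fun i j h => by
    simp only [Fin.mk.injEq] at h
    omega

theorem listing_fst (q : Fin (2 * n + 1)) (i : Fin n) :
    ((ofLex (listing q i).1).1 : ℕ) = if 2 * (i : ℕ) < q then (i : ℕ) else (q : ℕ) / 2 := by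
  unfold listing
  split_ifs <;> rfl

theorem listing_snd (q : Fin (2 * n + 1)) (i : Fin n) :
    ((ofLex (listing q i).1).2 : ℕ) = if 2 * (i : ℕ) < q then ((q : ℕ) - 1) / 2 else (i : ℕ) := by
  unfold listing
  split_ifs <;> rfl

theorem listing_mem (q : Fin (2 * n + 1)) (i : Fin n) : listing q i ∈ positions q := by
  rw [positions_eq_image]
  exact Finset.mem_image_of_mem _ (Finset.mem_univ i)

theorem listing_strictMono (q : Fin (2 * n + 1)) : StrictMono (listing q) := by
  intro i j hij
  rw [← Subtype.coe_lt_coe, Prod.Lex.lt_iff, Fin.lt_def, Fin.ext_iff, Fin.lt_def, listing_fst,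
    listing_fst, listing_snd, listing_snd]
  rw [Fin.lt_def] at hij
  split_ifs <;> omega

theorem orderIsoOfFin_positions (q : Fin (2 * n + 1)) (i : Fin n) :
    (positions q).orderIsoOfFin (card_positions q) i = ⟨listing q i, listing_mem q i⟩ := by
  apply Subtype.ext
  rw [Finset.coe_orderIsoOfFin_apply]
  exact (congrFun (Finset.orderEmbOfFin_unique (card_positions q) (listing_mem q)
    (listing_strictMono q)) i).symm

end Combinatorics

variable {F : Type*} [Field F] {n : ℕ}

/-! ### Placed matrices -/

theorem place_listing (q : Fin (2 * n + 1)) (A : Matrix (Fin n) (Fin n) F) (i j : Fin n) :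
    place q A (listing q i) (listing q j) = A i j := by
  have h (i : Fin n) : ((positions q).orderIsoOfFin (card_positions q)).symm
      ⟨listing q i, listing_mem q i⟩ = i := by
    rw [← orderIsoOfFin_positions, OrderIso.symm_apply_apply]
  simp only [place, of_apply]
  rw [dif_pos ⟨listing_mem q i, listing_mem q j⟩, h, h]

theorem place_of_notMem_left {q : Fin (2 * n + 1)} {x : Position n} (hx : x ∉ positions q)
    (A : Matrix (Fin n) (Fin n) F) (y : Position n) :
    place q A x y = if x = y then 1 else 0 := by
  simp only [place, of_apply]
  rw [dif_neg fun h => hx h.1]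

theorem place_of_notMem_right {q : Fin (2 * n + 1)} {y : Position n} (hy : y ∉ positions q)
    (A : Matrix (Fin n) (Fin n) F) (x : Position n) :
    place q A x y = if x = y then 1 else 0 := by
  simp only [place, of_apply]
  rw [dif_neg fun h => hy h.2]

theorem exists_listing_eq {q : Fin (2 * n + 1)} {x : Position n} (hx : x ∈ positions q) :
    ∃ i, listing q i = x := by
  simpa [positions_eq_image] using hx

/-- Right multiplication of a row by a placed matrix, in a position that the matrix acts on. -/
theorem vecMul_place_listing (q : Fin (2 * n + 1)) (A : Matrix (Fin n) (Fin n) F)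
    (u : Position n → F) (j : Fin n) :
    (u ᵥ* place q A) (listing q j) = ∑ i, u (listing q i) * A i j := by
  rw [vecMul, dotProduct,
    ← Finset.sum_subset (Finset.subset_univ (positions q)) fun x _ hx => ?_,
    positions_eq_image, Finset.sum_image (listing_injective q).injOn]
  · simp only [place_listing]
  · rw [place_of_notMem_left hx, if_neg, mul_zero]
    rintro rfl
    exact hx (listing_mem q j)

theorem vecMul_place_of_notMem {q : Fin (2 * n + 1)} {y : Position n} (hy : y ∉ positions q)
    (A : Matrix (Fin n) (Fin n) F) (u : Position n → F) :
    (u ᵥ* place q A) y = u y := by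
  simp [vecMul, dotProduct, place_of_notMem_right hy]

theorem place_mul (q : Fin (2 * n + 1)) (A B : Matrix (Fin n) (Fin n) F) :
    place q (A * B) = place q A * place q B := by
  refine ext_of_single_vecMul fun x => ?_
  generalize Pi.single (M := fun _ : Position n => F) x 1 = u
  rw [← vecMul_vecMul]
  ext y
  by_cases hy : y ∈ positions q
  · obtain ⟨j, rfl⟩ := exists_listing_eq hy
    simp only [vecMul_place_listing, mul_apply, Finset.mul_sum, Finset.sum_mul, mul_assoc]
    exact Finset.sum_comm
  · simp only [vecMul_place_of_notMem hy]

theorem place_one (q : Fin (2 * n + 1)) : place q (1 : Matrix (Fin n) (Fin n) F) = 1 := by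
  refine ext_of_single_vecMul fun x => ?_
  generalize Pi.single (M := fun _ : Position n => F) x 1 = u
  rw [vecMul_one]
  ext y
  by_cases hy : y ∈ positions q
  · obtain ⟨j, rfl⟩ := exists_listing_eq hy
    simp [vecMul_place_listing, one_apply]
  · simp only [vecMul_place_of_notMem hy]

/-! ### Products of lists -/

theorem vecMul_prod_ofFn {ι : Type*} [Fintype ι] [DecidableEq ι] (s : ℕ → ι → F) :
    ∀ (m : ℕ) (f : Fin m → Matrix ι ι F), (∀ t : Fin m, s t ᵥ* f t = s (t + 1)) →
      s 0 ᵥ* (List.ofFn f).prod = s m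
  | 0, _, _ => by simp
  | m + 1, f, h => by
    rw [List.ofFn_succ', List.concat_eq_append, List.prod_append, ← vecMul_vecMul,
      vecMul_prod_ofFn s m (fun i => f i.castSucc) fun t => h t.castSucc]
    simpa using h (Fin.last m)

theorem prod_ofFn_mul_prod_ofFn_rev {R : Type*} [Monoid R] :
    ∀ (m : ℕ) (f g : Fin m → R), (∀ k, f k * g k = 1) →
      (List.ofFn f).prod * (List.ofFn fun k => g k.rev).prod = 1
  | 0, _, _, _ => by simp
  | m + 1, f, g, h => by
    have ih := prod_ofFn_mul_prod_ofFn_rev m (fun k => f k.succ) (fun k => g k.succ)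
      fun k => h k.succ
    rw [List.ofFn_succ, List.ofFn_succ' (f := fun k => g k.rev), List.concat_eq_append,
      List.prod_append, List.prod_cons]
    simp only [Fin.rev_castSucc, Fin.rev_last, List.prod_cons, List.prod_nil, mul_one]
    rw [mul_assoc, ← mul_assoc (List.prod _) (List.prod _), ih, one_mul, h]

/-! ### Cramer's rule for Plücker coordinates -/

section Cramer

variable {M : Matrix (Fin (n + 1)) (Fin (2 * n + 1)) F}

theorem pluecker_ne_zero_of_injective
    (hM : ∀ c : Fin (n + 1) → Fin (2 * n + 1), StrictMono c → pluecker M c ≠ 0)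
    {c : Fin (n + 1) → Fin (2 * n + 1)} (hc : Function.Injective c) : pluecker M c ≠ 0 := by
  have h := hM (c ∘ Tuple.sort c)
    ((Tuple.monotone_sort c).strictMono_of_injective (hc.comp (Tuple.sort c).injective))
  intro h0
  apply h
  have := det_permute' (Tuple.sort c) (M.submatrix id c)
  rw [submatrix_submatrix] at this
  exact this.trans (by rw [show (M.submatrix id c).det = 0 from h0, mul_zero])

/-- Moving the new entry `t` from the front to the place of the omitted entry costs the sign
`(-1)^i`. -/
theorem pluecker_cons_removeNth (c : Fin (n + 1) → Fin (2 * n + 1)) (t : Fin (2 * n + 1))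
    (i : Fin (n + 1)) :
    pluecker M (Fin.cons t (i.removeNth c)) =
      (-1) ^ (i : ℕ) * ((M.submatrix id c).updateCol i fun r => M r t).det := by
  rw [pluecker, det_succ_column _ 0, det_succ_column _ i, Finset.mul_sum]
  refine Finset.sum_congr rfl fun r _ => ?_
  have hminor : ((M.submatrix id c).updateCol i fun r => M r t).submatrix r.succAbove i.succAbove =
      (M.submatrix id (Fin.cons t (i.removeNth c) : Fin (n + 1) → _)).submatrix
        r.succAbove (Fin.succAbove 0) := by
    ext x y
    simp [Fin.removeNth]
  have hsign : (-1 : F) ^ (i : ℕ) * (-1) ^ (i : ℕ) = 1 := by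
    rw [← mul_pow]
    simp
  rw [hminor]
  simp only [submatrix_apply, id, Fin.cons_zero, updateCol_self, Fin.val_zero, add_zero, pow_add]
  generalize ((M.submatrix id (Fin.cons t (i.removeNth c) : Fin (n + 1) → _)).submatrix
    r.succAbove (Fin.succAbove 0)).det = d
  linear_combination (-((-1) ^ (r : ℕ) * M r t * d)) * hsign

/-- Cramer's rule: the expansion of a vector in the columns `c_1, …, c_{n+1}`, under a linear
functional. -/
theorem pluecker_mul_apply (c : Fin (n + 1) → Fin (2 * n + 1)) (w : Fin (n + 1) → F)
    (φ : (Fin (n + 1) → F) →ₗ[F] F) :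
    pluecker M c * φ w =
      ∑ i, ((M.submatrix id c).updateCol i w).det * φ (M.col (c i)) := by
  have h : φ _ = φ _ := congrArg φ (mulVec_cramer (M.submatrix id c) w)
  rw [map_smul, smul_eq_mul] at h
  rw [pluecker, ← h, mulVec_eq_sum, map_sum]
  refine Finset.sum_congr rfl fun i _ => ?_
  rw [op_smul_eq_smul, map_smul, smul_eq_mul, cramer_apply]
  rfl

theorem eq_zero_of_apply_col_eq_zero {c : Fin (n + 1) → Fin (2 * n + 1)} (hc : pluecker M c ≠ 0)
    {φ : (Fin (n + 1) → F) →ₗ[F] F} (h : ∀ i, φ (M.col (c i)) = 0) : φ = 0 := by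
  refine LinearMap.ext fun w => ?_
  have := pluecker_mul_apply (M := M) c w φ
  simpa [h, hc] using this

theorem exists_apply_col_eq {c : Fin (n + 1) → Fin (2 * n + 1)} (hc : pluecker M c ≠ 0)
    (r : Fin (n + 1) → F) :
    ∃ φ : (Fin (n + 1) → F) →ₗ[F] F, ∀ i, φ (M.col (c i)) = r i := by
  have hu : IsUnit (M.submatrix id c).det := isUnit_iff_ne_zero.mpr hc
  refine ⟨dotProductBilin F F (r ᵥ* (M.submatrix id c)⁻¹), fun i => ?_⟩
  have h : (r ᵥ* (M.submatrix id c)⁻¹) ᵥ* M.submatrix id c = r := by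
    rw [vecMul_vecMul, nonsing_inv_mul _ hu, vecMul_one]
  exact congrFun h i

/-- The Plücker ratios express the column `t` modulo the column `q` in the columns
`s_1, …, s_n`, up to the sign `-1`. -/
theorem sum_mul_plueckerRatio {s : Fin n → Fin (2 * n + 1)} {q : Fin (2 * n + 1)}
    (hs : pluecker M (Fin.snoc s q) ≠ 0) (t : Fin (2 * n + 1))
    {φ : (Fin (n + 1) → F) →ₗ[F] F} (hφ : φ (M.col q) = 0) :
    ∑ i, φ (M.col (s i)) * plueckerRatio M s q t i = -φ (M.col t) := by
  have h := pluecker_mul_apply (M := M) (Fin.snoc s q) (M.col t) φ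
  rw [Fin.sum_univ_castSucc] at h
  simp only [Fin.snoc_castSucc, Fin.snoc_last, hφ, mul_zero, add_zero] at h
  apply mul_left_cancel₀ hs
  rw [mul_neg, h, Finset.mul_sum, ← Finset.sum_neg_distrib]
  refine Finset.sum_congr rfl fun i _ => ?_
  have hsign : (-1 : F) ^ (i : ℕ) * (-1) ^ (i : ℕ) = 1 := by
    rw [← mul_pow]
    simp
  have hcol : (fun r => M r t) = M.col t := rfl
  rw [plueckerRatio, pluecker_cons_removeNth, hcol, Fin.val_castSucc, pow_succ]
  generalize ((M.submatrix id (Fin.snoc s q : Fin (n + 1) → _)).updateCol i.castSucc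
    (M.col t)).det = d
  field_simp
  linear_combination (-(φ (M.col (s i)) * d)) * hsign

theorem mul_eq_one_of_plueckerRatio {s s' : Fin n → Fin (2 * n + 1)} {q : Fin (2 * n + 1)}
    (hs : pluecker M (Fin.snoc s q) ≠ 0) (hs' : pluecker M (Fin.snoc s' q) ≠ 0) :
    (of fun i j => plueckerRatio M s q (s' j) i) * (of fun i j => plueckerRatio M s' q (s j) i) =
      1 := by
  refine ext_of_single_vecMul fun x => ?_
  generalize Pi.single (M := fun _ : Fin n => F) x 1 = r
  obtain ⟨φ, hφ⟩ := exists_apply_col_eq hs (Fin.snoc r 0)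
  have hq : φ (M.col q) = 0 := by simpa using hφ (Fin.last n)
  have hr (i : Fin n) : φ (M.col (s i)) = r i := by simpa using hφ i.castSucc
  have h1 : r ᵥ* (of fun i j => plueckerRatio M s q (s' j) i) = fun j => -φ (M.col (s' j)) := by
    ext j
    simp only [vecMul, dotProduct, of_apply, ← hr]
    exact sum_mul_plueckerRatio hs _ hq
  rw [vecMul_one, ← vecMul_vecMul, h1]
  ext j
  simp only [vecMul, dotProduct, of_apply, neg_mul, Finset.sum_neg_distrib]
  rw [sum_mul_plueckerRatio hs' _ hq, neg_neg, hr]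

end Cramer

/-! ### Alternating forms and edge values -/

/-- The alternating bilinear form on `F^(n+1)` whose value on the standard basis vectors with
numbers `k < l + 1` is `p (k, l)`; as a function of its second argument it is bundled as a linear
map. -/
def form (p : Position n → F) (v : Fin (n + 1) → F) : (Fin (n + 1) → F) →ₗ[F] F where
  toFun w := ∑ x : Position n, p x *
    (v (ofLex x.1).1.castSucc * w (ofLex x.1).2.succ - v (ofLex x.1).2.succ * w (ofLex x.1).1.castSucc)
  map_add' w w' := by
    rw [← Finset.sum_add_distrib]
    refine Finset.sum_congr rfl fun x _ => ?_
    simp only [Pi.add_apply]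
    ring
  map_smul' a w := by
    rw [RingHom.id_apply, smul_eq_mul, Finset.mul_sum]
    refine Finset.sum_congr rfl fun x _ => ?_
    simp only [Pi.smul_apply, smul_eq_mul]
    ring

theorem form_apply (p : Position n → F) (v w : Fin (n + 1) → F) :
    form p v w = ∑ x : Position n, p x *
      (v (ofLex x.1).1.castSucc * w (ofLex x.1).2.succ -
        v (ofLex x.1).2.succ * w (ofLex x.1).1.castSucc) := rfl

theorem form_self (p : Position n → F) (v : Fin (n + 1) → F) : form p v v = 0 := by
  rw [form_apply]
  exact Finset.sum_eq_zero fun x _ => by ring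

theorem form_swap (p : Position n → F) (v w : Fin (n + 1) → F) : form p w v = -form p v w := by
  rw [form_apply, form_apply, ← Finset.sum_neg_distrib]
  exact Finset.sum_congr rfl fun x _ => by ring

theorem form_single (p : Position n → F) (x : Position n) :
    form p (Pi.single (ofLex x.1).1.castSucc 1) (Pi.single (ofLex x.1).2.succ 1) = p x := by
  rw [form_apply, Finset.sum_eq_single x]
  · have hx := x.2
    rw [Fin.le_def] at hx
    have h : (ofLex x.1).2.succ ≠ (ofLex x.1).1.castSucc := by
      rw [Ne, Fin.ext_iff, Fin.val_succ, Fin.val_castSucc]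
      omega
    simp [h]
  · intro y _ hyx
    have hx := x.2
    have hy := y.2
    rw [Fin.le_def] at hx hy
    have h1 : ¬((ofLex y.1).1 = (ofLex x.1).1 ∧ (ofLex y.1).2 = (ofLex x.1).2) := fun h =>
      hyx (Subtype.ext (Prod.ext h.1 h.2))
    have h2 : ¬((ofLex y.1).2.succ = (ofLex x.1).1.castSucc ∧
        (ofLex y.1).1.castSucc = (ofLex x.1).2.succ) := by
      simp only [Fin.ext_iff, Fin.val_succ, Fin.val_castSucc]
      omega
    simp only [Pi.single_apply, Fin.castSucc_inj, Fin.succ_inj, ← ite_and, mul_ite, mul_one,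
      mul_zero]
    rw [if_neg fun h => h1 ⟨h.2, h.1⟩, if_neg fun h => h2 ⟨h.2, h.1⟩, sub_zero, mul_zero]
  · simp

/-- The number `(-1)^(a+b) ω(v_a, v_b)`, `a < b`, on the edge `{a, b}` of the polygon, where `v` are
the columns of `M` and `ω = form p`; it is symmetric in `a` and `b`. -/
def edgeValue (M : Matrix (Fin (n + 1)) (Fin (2 * n + 1)) F) (p : Position n → F)
    (a b : Fin (2 * n + 1)) : F :=
  (-1) ^ ((a : ℕ) + b) * form p (M.col (min a b)) (M.col (max a b))

section EdgeValue

variable (M : Matrix (Fin (n + 1)) (Fin (2 * n + 1)) F) (p : Position n → F)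

theorem edgeValue_congr {a b c d : Fin (2 * n + 1)}
    (h : ((a : ℕ) = c ∧ (b : ℕ) = d) ∨ ((a : ℕ) = d ∧ (b : ℕ) = c)) :
    edgeValue M p a b = edgeValue M p c d := by
  simp only [← Fin.ext_iff] at h
  obtain ⟨rfl, rfl⟩ | ⟨rfl, rfl⟩ := h
  · rfl
  · rw [edgeValue, edgeValue, min_comm, max_comm, add_comm]

theorem edgeValue_aOdd (q : Fin (2 * n + 1)) (i : Fin n) :
    edgeValue M p q (aOdd q i) = -((-1) ^ (q : ℕ) * form p (M.col q) (M.col (aOdd q i))) := by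
  have hv := aOdd_val q i
  split_ifs at hv with h
  · have hlt : aOdd q i ≤ q := by
      rw [Fin.le_def]
      omega
    rw [edgeValue, min_eq_right hlt, max_eq_left hlt, form_swap, hv, pow_add, pow_mul]
    simp
  · have hlt : q ≤ aOdd q i := by
      rw [Fin.le_def]
      omega
    rw [edgeValue, min_eq_left hlt, max_eq_right hlt, hv, pow_add, pow_succ, pow_mul]
    simp

theorem edgeValue_aEven (q : Fin (2 * n + 1)) (i : Fin n) :
    edgeValue M p q (aEven q i) = (-1) ^ (q : ℕ) * form p (M.col q) (M.col (aEven q i)) := by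
  have hv := aEven_val q i
  split_ifs at hv with h
  · have hlt : aEven q i ≤ q := by
      rw [Fin.le_def]
      omega
    rw [edgeValue, min_eq_right hlt, max_eq_left hlt, form_swap, hv, pow_add, pow_succ, pow_mul]
    simp
  · have hlt : q ≤ aEven q i := by
      rw [Fin.le_def]
      omega
    rw [edgeValue, min_eq_left hlt, max_eq_right hlt, hv, pow_add, pow_add, pow_mul]
    simp

variable {M}

/-- The matrix `A⁽q⁾` carries the values on the edges `{q, a_1}, {q, a_3}, …` to the values on the
edges `{q, a_2}, {q, a_4}, …`. -/
theorem sum_edgeValue_mul_matA {q : Fin (2 * n + 1)} (hq : pluecker M (Fin.snoc (aOdd q) q) ≠ 0)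
    (j : Fin n) :
    ∑ i, edgeValue M p q (aOdd q i) * matA M q i j = edgeValue M p q (aEven q j) := by
  have h := sum_mul_plueckerRatio hq (aEven q j) (form_self p (M.col q))
  simp only [edgeValue_aOdd, edgeValue_aEven, matA, of_apply, neg_mul, mul_assoc,
    Finset.sum_neg_distrib]
  rw [← Finset.mul_sum, h]
  ring

/-- If a row holds the values on the edges `{q, a_1}, {q, a_3}, …` in the positions `𝓑_q`, the
placed matrix `A⁽q⁾` replaces them by the values on `{q, a_2}, {q, a_4}, …`. -/
theorem vecMul_place_matA {q : Fin (2 * n + 1)} (hq : pluecker M (Fin.snoc (aOdd q) q) ≠ 0)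
    {u u' : Position n → F} (hu : ∀ i, u (listing q i) = edgeValue M p q (aOdd q i))
    (hu' : ∀ i, u' (listing q i) = edgeValue M p q (aEven q i))
    (huu' : ∀ x, x ∉ positions q → u x = u' x) :
    u ᵥ* place q (matA M q) = u' := by
  ext x
  by_cases hx : x ∈ positions q
  · obtain ⟨j, rfl⟩ := exists_listing_eq hx
    simp only [vecMul_place_listing, hu, hu']
    exact sum_edgeValue_mul_matA p hq j
  · rw [vecMul_place_of_notMem hx, huu' x hx]

end EdgeValue

/-! ### The rows of edge values along both sides of the polygon equation -/

section States

variable (M : Matrix (Fin (n + 1)) (Fin (2 * n + 1)) F) (p : Position n → F)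

/-- The row of edge values after the first `t` odd vertices have acted (the vertices `2k` and `2l+2`
below are odd ones, as numbers start from `0`). Position `(k, l)` starts
with the edge `{2k, 2l+1}`; the vertex `2k` turns it into `{2k, 2l+2}`, and then the vertex `2l+2`
turns it into `{2k+1, 2l+2}`. -/
def oddState (t : ℕ) (x : Position n) : F :=
  edgeValue M p
    ⟨if t ≤ (ofLex x.1).2 + 1 then 2 * (ofLex x.1).1 else 2 * (ofLex x.1).1 + 1, by
      split_ifs <;> omega⟩
    ⟨if t ≤ (ofLex x.1).1 then 2 * (ofLex x.1).2 + 1 else 2 * (ofLex x.1).2 + 2, by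
      split_ifs <;> omega⟩

/-- The row of edge values after the last `t` even vertices have acted. Position `(k, l)` starts
with the edge `{2k, 2l+1}`; for `k < l` the vertex `2l+1` turns it into `{2k+1, 2l+1}`, and then the
vertex `2k+1` turns it into `{2k+1, 2l+2}`, while for `k = l` both changes happen at once. -/
def evenState (t : ℕ) (x : Position n) : F :=
  edgeValue M p
    ⟨if n ≤ (ofLex x.1).2 + t then 2 * (ofLex x.1).1 + 1 else 2 * (ofLex x.1).1, by
      split_ifs <;> omega⟩
    ⟨if n ≤ (ofLex x.1).1 + t then 2 * (ofLex x.1).2 + 2 else 2 * (ofLex x.1).2 + 1, by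
      split_ifs <;> omega⟩

theorem evenState_zero : evenState M p 0 = oddState M p 0 := by
  ext x
  apply edgeValue_congr
  simp only
  split_ifs <;> omega

theorem evenState_eq_oddState : evenState M p n = oddState M p (n + 1) := by
  ext x
  apply edgeValue_congr
  simp only
  split_ifs <;> omega

variable {M}

theorem oddState_vecMul (hM : ∀ q, pluecker M (Fin.snoc (aOdd q) q) ≠ 0) (t : Fin (n + 1)) :
    oddState M p t ᵥ* place (oddVertex t) (matA M (oddVertex t)) = oddState M p (t + 1) := by
  have hq : (oddVertex t : ℕ) = 2 * t := rfl
  refine vecMul_place_matA p (hM _) (fun i => ?_) (fun i => ?_) fun x hx => ?_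
  · apply edgeValue_congr
    simp only [listing_fst, listing_snd, aOdd_val, hq]
    split_ifs <;> omega
  · apply edgeValue_congr
    simp only [listing_fst, listing_snd, aEven_val, hq]
    split_ifs <;> omega
  · rw [mem_positions, hq] at hx
    apply edgeValue_congr
    simp only
    split_ifs <;> omega

theorem evenState_vecMul (hM : ∀ q, pluecker M (Fin.snoc (aOdd q) q) ≠ 0) (t : Fin n) :
    evenState M p t ᵥ* place (evenVertex t.rev) (matA M (evenVertex t.rev)) =
      evenState M p (t + 1) := by
  have hq : (evenVertex t.rev : ℕ) = 2 * (n - (t + 1)) + 1 := by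
    simp only [evenVertex, Fin.val_rev]
  refine vecMul_place_matA p (hM _) (fun i => ?_) (fun i => ?_) fun x hx => ?_
  · apply edgeValue_congr
    simp only [listing_fst, listing_snd, aOdd_val, hq]
    split_ifs <;> omega
  · apply edgeValue_congr
    simp only [listing_fst, listing_snd, aEven_val, hq]
    split_ifs <;> omega
  · rw [mem_positions, hq] at hx
    apply edgeValue_congr
    simp only
    split_ifs <;> omega

end States

/-! ### The initial rows fill the whole space -/

section Initial

variable {M : Matrix (Fin (n + 1)) (Fin (2 * n + 1)) F}

theorem oddState_zero (p : Position n → F) (x : Position n) :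
    oddState M p 0 x = -form p (M.col (initialPair x).1) (M.col (initialPair x).2) := by
  have hx := x.2
  rw [Fin.le_def] at hx
  have h : (initialPair x).1 ≤ (initialPair x).2 := by
    simp only [initialPair, oddVertex, evenVertex, Fin.le_def, Fin.val_castSucc]
    omega
  have h' : oddState M p 0 x = edgeValue M p (initialPair x).1 (initialPair x).2 := by
    apply edgeValue_congr
    simp [initialPair, oddVertex, evenVertex]
  rw [h', edgeValue, min_eq_left h, max_eq_right h]
  simp [initialPair, oddVertex, evenVertex, pow_add, pow_mul]

theorem form_eq_zero
    (hM : ∀ c : Fin (n + 1) → Fin (2 * n + 1), Function.Injective c → pluecker M c ≠ 0)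
    {p : Position n → F}
    (hp : ∀ x : Position n, form p (M.col (initialPair x).1) (M.col (initialPair x).2) = 0)
    (v : Fin (n + 1) → F) : form p v = 0 := by
  have key (m : ℕ) : ∀ hm : m < n + 1, form p (M.col (oddVertex ⟨m, hm⟩)) = 0 := by
    induction m using Nat.strong_induction_on with
    | _ m ih =>
      intro hm
      refine eq_zero_of_apply_col_eq_zero (hM _ (snoc_aOdd_injective (oddVertex ⟨m, hm⟩))) ?_
      refine Fin.lastCases ?_ fun i => ?_
      · rw [Fin.snoc_last, form_self]
      · rw [Fin.snoc_castSucc]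
        have hv : (aOdd (oddVertex ⟨m, hm⟩) i : ℕ) =
            if 2 * (i : ℕ) < 2 * m then 2 * (i : ℕ) else 2 * i + 1 := aOdd_val _ i
        split_ifs at hv with h
        · have : aOdd (oddVertex ⟨m, hm⟩) i = oddVertex ⟨i, by omega⟩ := Fin.ext hv
          rw [this, form_swap, ih i (by omega), LinearMap.zero_apply, neg_zero]
        · have := hp ⟨toLex (⟨m, by omega⟩, i), by simp only [ofLex_toLex, Fin.le_def]; omega⟩
          have h' : aOdd (oddVertex ⟨m, hm⟩) i = evenVertex i := Fin.ext hv
          rw [h']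
          exact this
  have hodd : Function.Injective (oddVertex : Fin (n + 1) → Fin (2 * n + 1)) := by
    intro i j h
    simp only [oddVertex, Fin.mk.injEq] at h
    omega
  refine eq_zero_of_apply_col_eq_zero (hM _ hodd) fun i => ?_
  rw [form_swap, key i i.2, LinearMap.zero_apply, neg_zero]

theorem exists_oddState_zero_eq
    (hM : ∀ c : Fin (n + 1) → Fin (2 * n + 1), Function.Injective c → pluecker M c ≠ 0)
    (u : Position n → F) : ∃ p, oddState M p 0 = u := by
  let T : (Position n → F) →ₗ[F] (Position n → F) :=
    { toFun := fun p => oddState M p 0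
      map_add' := fun p p' => by
        ext x
        simp only [oddState_zero, Pi.add_apply, form_apply, add_mul, Finset.sum_add_distrib]
        ring
      map_smul' := fun a p => by
        ext x
        simp only [oddState_zero, Pi.smul_apply, smul_eq_mul, form_apply, mul_assoc,
          ← Finset.mul_sum, RingHom.id_apply, mul_neg] }
  have hT : Function.Injective T := by
    rw [injective_iff_map_eq_zero]
    intro p hp
    have h0 (x : Position n) :
        form p (M.col (initialPair x).1) (M.col (initialPair x).2) = 0 := by
      rw [← neg_eq_zero, ← oddState_zero]
      exact congrFun hp x
    ext x
    rw [← form_single p x, form_eq_zero hM h0]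
    rfl
  exact LinearMap.injective_iff_surjective.mp hT u

end Initial

end Polygon

open Polygon Matrix in
theorem theorem1 {F : Type*} [Field F] (n : ℕ)
    (M : Matrix (Fin (n + 1)) (Fin (2 * n + 1)) F)
    (hM : ∀ c : Fin (n + 1) → Fin (2 * n + 1), StrictMono c → Polygon.pluecker M c ≠ 0) :
    Polygon.PolygonEquation (Polygon.matA M) ∧
      (∀ q : Fin (2 * n + 1),
        Polygon.matA M q * Polygon.matB M q = 1 ∧ Polygon.matB M q * Polygon.matA M q = 1) ∧
      Polygon.InversePolygonEquation (Polygon.matB M) := by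
  have hM' (c : Fin (n + 1) → Fin (2 * n + 1)) (hc : Function.Injective c) : pluecker M c ≠ 0 :=
    pluecker_ne_zero_of_injective hM hc
  have hOdd (q) : pluecker M (Fin.snoc (aOdd q) q) ≠ 0 := hM' _ (snoc_aOdd_injective q)
  have hEven (q) : pluecker M (Fin.snoc (aEven q) q) ≠ 0 := hM' _ (snoc_aEven_injective q)
  have hA : PolygonEquation (matA M) := by
    refine ext_of_single_vecMul fun x => ?_
    obtain ⟨p, hp⟩ := exists_oddState_zero_eq hM' (Pi.single x (1 : F))
    rw [← hp, vecMul_prod_ofFn (oddState M p) _ _ (oddState_vecMul p hOdd), ← evenState_zero,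
      vecMul_prod_ofFn (evenState M p) _ _ (evenState_vecMul p hOdd), evenState_eq_oddState]
  have hAB (q) : matA M q * matB M q = 1 := mul_eq_one_of_plueckerRatio (hOdd q) (hEven q)
  have hBA (q) : matB M q * matA M q = 1 := mul_eq_one_of_plueckerRatio (hEven q) (hOdd q)
  refine ⟨hA, fun q => ⟨hAB q, hBA q⟩, ?_⟩
  have h1 := prod_ofFn_mul_prod_ofFn_rev (n + 1)
    (fun k => place (oddVertex k) (matA M (oddVertex k)))
    (fun k => place (oddVertex k) (matB M (oddVertex k)))
    fun k => by rw [← place_mul, hAB, place_one]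
  have h2 := prod_ofFn_mul_prod_ofFn_rev n
    (fun k => place (evenVertex k) (matB M (evenVertex k)))
    (fun k => place (evenVertex k) (matA M (evenVertex k)))
    fun k => by rw [← place_mul, hBA, place_one]
  unfold PolygonEquation at hA
  beta_reduce at h1 h2
  rw [hA] at h1
  exact left_inv_eq_right_inv h2 h1
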